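/- Let $p(0)=1$ and, for each integer $i\ge 1$, let $p(i),q(i)>0$ with $p(i)+q(i)=1$. Consider the $(1,1)$ reflecting random walk (birth–death chain) on $\{0,1,2,\dots\}$, i.e. the Markov chain with transition probabilities $$P_{i,i+1}=p(i)\quad(i\ge 0),\qquad P_{i,i-1}=q(i)\quad(i\ge 1),\qquad P_{ij}=0\ \text{ otherwise.}$$ Set $$\mu_0=1,\qquad \mu_i=\frac{p(0)p(1)\cdots p(i-1)}{q(1)q(2)\cdots q(i)}\quad(i\ge 1),\qquad \mu=\sum_{i=0}^{\infty}\mu_i\in(0,\infty].$$ Then a stationary distribution of the chain (a probability distribution $\pi=(\pi_i)_{i\ge 0}$ with $\sum_{i}\pi_iP_{ij}=\pi_j$ for all $j\ge 0$) exists if and only if $\mu<\infty$. In this case the stationary distribution is unique and is given by $\pi_i=\mu_i/\mu$ for all $i\ge 0$. -/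

import Mathlib

open MeasureTheory ProbabilityTheory
open scoped ENNReal

/-- Transition probabilities `P i j` of the `(1,1)` reflecting random walk on `ℕ`:
from `i` to `i + 1` with probability `p i`, and from `i ≥ 1` to `i - 1` with probability `q i`.
The value `q 0` plays no role. -/
noncomputable def walkProb (p q : ℕ → ℝ) (i j : ℕ) : ℝ :=
  if j = i + 1 then p i else if i = j + 1 then q i else 0

/-- The one-step transition kernel with `walkKernel p q i {j} = P i j`. -/
noncomputable def walkKernel (p q : ℕ → ℝ) : Kernel ℕ ℕ :=
  Kernel.ofFunOfCountable fun i =>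
    Measure.sum fun j => ENNReal.ofReal (walkProb p q i j) • Measure.dirac j

/-- A stationary distribution of a Markov kernel: an invariant probability measure. -/
def IsStationaryDistribution (κ : Kernel ℕ ℕ) (π : Measure ℕ) : Prop :=
  IsProbabilityMeasure π ∧ κ.Invariant π

/-- `μ_i = p(0) ⋯ p(i-1) / (q(1) ⋯ q(i))`, with `μ_0 = 1`. -/
noncomputable def walkWeight (p q : ℕ → ℝ) (i : ℕ) : ℝ :=
  (∏ k ∈ Finset.range i, p k) / ∏ k ∈ Finset.Icc 1 i, q k

/-- `μ = ∑_{i ≥ 0} μ_i`, as an element of `[0, ∞]`. -/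
noncomputable def walkTotalWeight (p q : ℕ → ℝ) : ℝ≥0∞ :=
  ∑' i, ENNReal.ofReal (walkWeight p q i)

/-! The walk crosses only edges between neighbours, so the stationarity equations, solved upward
from state 0, force zero net flow across each edge (`detailed_balance_of_walkKernel_invariant`).
Hence `π {i} = π {0} * μ_i`, and total mass 1 gives `π {0} * μ = 1`: so `μ` is finite and `π` is
determined. Conversely, the `μ_i` satisfy detailed balance, so for finite `μ` they can be
normalised. -/

lemma walkKernel_apply_singleton (p q : ℕ → ℝ) (i j : ℕ) :
    walkKernel p q i {j} = ENNReal.ofReal (walkProb p q i j) := by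
  change (Measure.sum fun j => ENNReal.ofReal (walkProb p q i j) • Measure.dirac j) {j} = _
  rw [Measure.sum_apply _ (measurableSet_singleton j), tsum_eq_single j]
  · simp
  · intro k hk
    simp [hk]

lemma bind_walkKernel_singleton (p q : ℕ → ℝ) (π : Measure ℕ) (j : ℕ) :
    π.bind (walkKernel p q) {j} = ∑' i, ENNReal.ofReal (walkProb p q i j) * π {i} := by
  rw [Measure.bind_apply (measurableSet_singleton j) (walkKernel p q).aemeasurable,
    lintegral_countable']
  simp_rw [walkKernel_apply_singleton]

lemma bind_walkKernel_zero (p q : ℕ → ℝ) (π : Measure ℕ) :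
    π.bind (walkKernel p q) {0} = ENNReal.ofReal (q 1) * π {1} := by
  rw [bind_walkKernel_singleton, tsum_eq_single 1]
  · simp [walkProb]
  · intro i hi
    simp [walkProb, hi]

lemma bind_walkKernel_succ (p q : ℕ → ℝ) (π : Measure ℕ) (j : ℕ) :
    π.bind (walkKernel p q) {j + 1} =
      ENNReal.ofReal (p j) * π {j} + ENNReal.ofReal (q (j + 2)) * π {j + 2} := by
  rw [bind_walkKernel_singleton, tsum_eq_sum (s := {j, j + 2}), Finset.sum_pair (by omega)]
  · simp [walkProb]
  · intro i hi
    simp only [Finset.mem_insert, Finset.mem_singleton, not_or] at hi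
    have h1 : j ≠ i := by omega
    have h2 : i ≠ j + 1 + 1 := by omega
    simp [walkProb, h1, h2]

/-- The stationarity equations of the walk. -/
lemma walkKernel_invariant_iff (p q : ℕ → ℝ) (π : Measure ℕ) :
    (walkKernel p q).Invariant π ↔ ENNReal.ofReal (q 1) * π {1} = π {0} ∧
      ∀ j, ENNReal.ofReal (p j) * π {j} + ENNReal.ofReal (q (j + 2)) * π {j + 2} = π {j + 1} := by
  rw [Kernel.Invariant, Measure.ext_iff_singleton, ← bind_walkKernel_zero p q π]
  simp_rw [← bind_walkKernel_succ]
  exact ⟨fun h => ⟨h 0, fun j => h (j + 1)⟩, fun h j => by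
    cases j with
    | zero => exact h.1
    | succ j => exact h.2 j⟩

lemma walkWeight_zero (p q : ℕ → ℝ) : walkWeight p q 0 = 1 := by
  simp [walkWeight]

lemma mul_walkWeight_succ (p q : ℕ → ℝ) (hq : ∀ i, 1 ≤ i → 0 < q i) (i : ℕ) :
    q (i + 1) * walkWeight p q (i + 1) = p i * walkWeight p q i := by
  have h := (hq (i + 1) (by omega)).ne'
  have h' : ∏ k ∈ Finset.Icc 1 i, q k ≠ 0 :=
    Finset.prod_ne_zero_iff.2 fun k hk => (hq k (Finset.mem_Icc.1 hk).1).ne'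
  rw [walkWeight, walkWeight, Finset.prod_range_succ, Finset.prod_Icc_succ_top (by omega)]
  field_simp

/-- Detailed balance for the weights, in `[0, ∞]`. -/
lemma ofReal_mul_ofReal_walkWeight_succ (p q : ℕ → ℝ) (hp : ∀ i, 0 < p i)
    (hq : ∀ i, 1 ≤ i → 0 < q i) (i : ℕ) :
    ENNReal.ofReal (q (i + 1)) * ENNReal.ofReal (walkWeight p q (i + 1)) =
      ENNReal.ofReal (p i) * ENNReal.ofReal (walkWeight p q i) := by
  rw [← ENNReal.ofReal_mul (hq _ (by omega)).le, ← ENNReal.ofReal_mul (hp i).le,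
    mul_walkWeight_succ p q hq]

/-- A measure with weights proportional to `walkWeight` is invariant. -/
lemma walkKernel_invariant_of_eq_mul_walkWeight (p q : ℕ → ℝ) (hp0 : p 0 = 1)
    (hp : ∀ i, 0 < p i) (hq : ∀ i, 1 ≤ i → 0 < q i) (hpq : ∀ i, 1 ≤ i → p i + q i = 1)
    (π : Measure ℕ) (c : ℝ≥0∞) (hπ : ∀ i, π {i} = c * ENNReal.ofReal (walkWeight p q i)) :
    (walkKernel p q).Invariant π := by
  have hbal := ofReal_mul_ofReal_walkWeight_succ p q hp hq
  rw [walkKernel_invariant_iff]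
  simp_rw [hπ, mul_left_comm _ c]
  refine ⟨by simpa [hp0] using congrArg (c * ·) (hbal 0), fun j => ?_⟩
  -- Balance on the two edges at `j + 1` turns the inflow into the outflow `(q (j + 1) + p (j + 1))
  -- * μ_{j+1}`.
  rw [hbal (j + 1), ← hbal j, ← mul_add, ← add_mul,
    ← ENNReal.ofReal_add (hq _ (by omega)).le (hp _).le, add_comm, hpq _ (by omega)]
  simp

/-- A finite invariant measure of the walk satisfies detailed balance. -/
lemma detailed_balance_of_walkKernel_invariant (p q : ℕ → ℝ) (hp0 : p 0 = 1)
    (hp : ∀ i, 0 < p i) (hq : ∀ i, 1 ≤ i → 0 < q i) (hpq : ∀ i, 1 ≤ i → p i + q i = 1)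
    (π : Measure ℕ) [IsFiniteMeasure π] (hπ : (walkKernel p q).Invariant π) (i : ℕ) :
    ENNReal.ofReal (q (i + 1)) * π {i + 1} = ENNReal.ofReal (p i) * π {i} := by
  rw [walkKernel_invariant_iff] at hπ
  induction i with
  | zero => simpa [hp0] using hπ.1
  | succ i ih =>
    have h := hπ.2 i
    rw [← ih] at h
    have h1 : ENNReal.ofReal (q (i + 1)) * π {i + 1} + ENNReal.ofReal (p (i + 1)) * π {i + 1} =
        π {i + 1} := by
      rw [← add_mul, ← ENNReal.ofReal_add (hq _ (by omega)).le (hp _).le, add_comm,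
        hpq _ (by omega)]
      simp
    -- Cancelling the common flow `q (i + 1) * π {i + 1}` in `[0, ∞]` needs it finite, hence the
    -- finite measure.
    exact (ENNReal.add_right_inj (by finiteness)).1 (h.trans h1.symm)

lemma eq_mul_walkWeight_of_walkKernel_invariant (p q : ℕ → ℝ) (hp0 : p 0 = 1)
    (hp : ∀ i, 0 < p i) (hq : ∀ i, 1 ≤ i → 0 < q i) (hpq : ∀ i, 1 ≤ i → p i + q i = 1)
    (π : Measure ℕ) [IsFiniteMeasure π] (hπ : (walkKernel p q).Invariant π) (i : ℕ) :
    π {i} = π {0} * ENNReal.ofReal (walkWeight p q i) := by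
  induction i with
  | zero => simp [walkWeight_zero]
  | succ i ih =>
    have h := detailed_balance_of_walkKernel_invariant p q hp0 hp hq hpq π hπ i
    rw [ih, mul_left_comm, ← ofReal_mul_ofReal_walkWeight_succ p q hp hq, mul_left_comm] at h
    exact (ENNReal.mul_right_inj (by simpa using hq (i + 1) (by omega)) (by finiteness)).1 h

lemma measure_zero_mul_walkTotalWeight (p q : ℕ → ℝ) (hp0 : p 0 = 1)
    (hp : ∀ i, 0 < p i) (hq : ∀ i, 1 ≤ i → 0 < q i) (hpq : ∀ i, 1 ≤ i → p i + q i = 1)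
    (π : Measure ℕ) (hπ : IsStationaryDistribution (walkKernel p q) π) :
    π {0} * walkTotalWeight p q = 1 := by
  have := hπ.1
  rw [walkTotalWeight, ← ENNReal.tsum_mul_left]
  simp_rw [← eq_mul_walkWeight_of_walkKernel_invariant p q hp0 hp hq hpq π hπ.2]
  rw [← measure_univ (μ := π), ← lintegral_one, lintegral_countable']
  simp

lemma walkTotalWeight_ne_zero (p q : ℕ → ℝ) : walkTotalWeight p q ≠ 0 := by
  intro h
  have := ENNReal.tsum_eq_zero.1 h 0
  simp [walkWeight_zero] at this

lemma exists_isStationaryDistribution_walkKernel (p q : ℕ → ℝ) (hp0 : p 0 = 1)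
    (hp : ∀ i, 0 < p i) (hq : ∀ i, 1 ≤ i → 0 < q i) (hpq : ∀ i, 1 ≤ i → p i + q i = 1)
    (hfin : walkTotalWeight p q < ∞) :
    ∃ π : Measure ℕ, IsStationaryDistribution (walkKernel p q) π := by
  refine ⟨(walkTotalWeight p q)⁻¹ •
    Measure.sum fun i => ENNReal.ofReal (walkWeight p q i) • Measure.dirac i, ⟨?_⟩, ?_⟩
  · rw [Measure.smul_apply, Measure.sum_apply _ MeasurableSet.univ]
    simpa [walkTotalWeight] using
      ENNReal.inv_mul_cancel (walkTotalWeight_ne_zero p q) hfin.ne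
  · refine walkKernel_invariant_of_eq_mul_walkWeight p q hp0 hp hq hpq _
      (walkTotalWeight p q)⁻¹ fun i => ?_
    rw [Measure.smul_apply, Measure.sum_apply _ (measurableSet_singleton i), tsum_eq_single i]
    · simp
    · intro k hk
      simp [hk]

theorem corollaryc3p2 (p q : ℕ → ℝ) (hp0 : p 0 = 1)
    (hp : ∀ i, 1 ≤ i → 0 < p i) (hq : ∀ i, 1 ≤ i → 0 < q i)
    (hpq : ∀ i, 1 ≤ i → p i + q i = 1) :
    ((∃ π : Measure ℕ, IsStationaryDistribution (walkKernel p q) π) ↔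
      walkTotalWeight p q < ∞) ∧
    (walkTotalWeight p q < ∞ →
      ∀ π : Measure ℕ, IsStationaryDistribution (walkKernel p q) π →
        ∀ i, π {i} = ENNReal.ofReal (walkWeight p q i) / walkTotalWeight p q) := by
  have hp' : ∀ i, 0 < p i := fun i => by
    rcases Nat.eq_zero_or_pos i with rfl | hi
    · simp [hp0]
    · exact hp i hi
  refine ⟨⟨?_, exists_isStationaryDistribution_walkKernel p q hp0 hp' hq hpq⟩, ?_⟩
  · rintro ⟨π, hπ⟩
    have h := measure_zero_mul_walkTotalWeight p q hp0 hp' hq hpq π hπ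
    refine lt_top_iff_ne_top.2 fun htop => ?_
    rw [htop] at h
    -- In `[0, ∞]`, `π {0} * ∞` is 0 or `∞`, never 1.
    rcases eq_or_ne (π {0}) 0 with h0 | h0
    · simp [h0] at h
    · simp [ENNReal.mul_top h0] at h
  · intro _ π hπ i
    have := hπ.1
    rw [eq_mul_walkWeight_of_walkKernel_invariant p q hp0 hp' hq hpq π hπ.2 i,
      ENNReal.eq_inv_of_mul_eq_one_left
        (measure_zero_mul_walkTotalWeight p q hp0 hp' hq hpq π hπ),
      mul_comm, div_eq_mul_inv]
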